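/- **Setting.** Let $\mathcal X\subset\mathbb R^k$, let $\mathcal S$ be a non-empty finite set, let $\Phi\subset\mathbb R^d$, and let $f:\mathcal X\times\mathcal S\to\mathbb R^D$, $g:\mathcal X\times\Phi\times\mathcal S\to\mathbb R^J$. Let $\Delta^{D-1}=\{\theta\in\mathbb R^D:\theta\ge 0,\ \sum_i\theta_i=1\}$. Put $\mathcal X(\phi,s)=\{x\in\mathcal X: g(x,\phi,s)\le 0\}$ and $$\mathbf{FOP}(\theta,\phi,s)=\operatorname*{argmax}_{x\in\mathcal X(\phi,s)}\theta^\top f(x,s),$$ $$\ell^{\mathrm{sub},0}(x,\theta,\phi,s)=\max\Bigl(\max_{x'\in\mathcal X(\phi,s)}\theta^\top f(x',s)-\theta^\top f(x,s),\,0\Bigr).$$ **Assumptions.** (i) For all $s\in\mathcal S$ and $\phi\in\Phi$, $f(\cdot,s)$ and $g(\cdot,\phi,s)$ are piecewise linear on $\mathcal X$, and $\mathcal X(\phi,s)$ is a finite union of bounded convex polyhedra. $\mathcal Y(\phi,s)$ denotes the set of vertices of the polyhedra in some presentation of $f(\mathcal X(\phi,s),s)$ as a finite union of bounded convex polyhedra.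 (ii) $\Phi$ is closed under componentwise $\wedge$ and $\vee$, and for all $x\in\mathcal X$, $s\in\mathcal S$ the map $g(x,\cdot,s):\Phi\to\mathbb R^J$ preserves $\wedge$ and $\vee$. (iii) $\mathbb P_{\mathcal S}$ is a probability distribution on $\mathcal S$, and $s^{(1)},\dots,s^{(N)}\in\mathcal S$ are the data, in which every state of $\mathcal S$ occurs at least once. **Algorithm.** Let $\hat x^*:\mathcal S\to\mathcal X$ be the observed solutions. *Stage 1.* Let $\phi^{\sup}$ be the greatest element (componentwise order) of $\{\phi\in\Phi: g(\hat x^*(s),\phi,s)\le 0\ \text{for all } s\in\mathcal S\}$, assumed to exist. *Stage 2.* Let $x^*$ be a solver that returns $x^*(\theta,s)\in\mathbf{FOP}(\theta,\phi^{\sup},s)$ with $f(x^*(\theta,s),s)\in\mathcal Y(\phi^{\sup},s)$ for all $\theta\in\Delta^{D-1}$, $s\in\mathcal S$. Put $F(\theta,s)=f(x^*(\theta,s),s)-f(\hat x^*(s),s)$ and $\bar F(\theta)=\frac1N\sum_{n=1}^N F(\theta,s^{(n)})$. Start from any $\theta^1\in\Delta^{D-1}$; for $i=1,\dots,K-1$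 let $\theta^{i+1}$ be the Euclidean projection onto $\Delta^{D-1}$ of $\theta^i-\alpha_i\bar F(\theta^i)$, with $\alpha_i=i^{-1/2}\|\bar F(\theta^i)\|^{-1}$ (and $\theta^{i+1}=\theta^i$ if $\bar F(\theta^i)=0$). Let $\theta^{\sup}$ be an element of $\{\theta^1,\dots,\theta^K\}$ that minimises $\frac1N\sum_{n=1}^N\ell^{\mathrm{sub},0}(\hat x^*(s^{(n)}),\theta,\phi^{\sup},s^{(n)})$ over this set. **Number of iterations.** For $\theta^{\mathrm{true}}\in\Delta^{D-1}$ let $$G=\frac1N\sum_{n=1}^N\sup_{\xi_1,\xi_2\in f(\mathcal X(\phi^{\sup},s^{(n)}),s^{(n)})}\|\xi_1-\xi_2\|,\qquad \gamma=-\frac1{4NG}\max_{\substack{\theta\in\Delta^{D-1}\\ \bar F(\theta)\ne 0}}\ \sum_{n=1}^N(\theta^{\mathrm{true}})^\top F(\theta,s^{(n)}).$$ Suppose that $K\ge 1$ and $$K\ \ge\ \Bigl(\frac2\gamma\Bigr)^2\Bigl(\frac{\|\theta^1-\theta^{\mathrm{true}}\|^2+\gamma+1}{2}+\log\frac2\gamma\Bigr)^2,$$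 where the second condition is void if $\bar F(\theta)=0$ for every $\theta\in\Delta^{D-1}$. **Theorem.** Let $\phi^{\mathrm{true}}\in\Phi$. Then for almost every $\theta^{\mathrm{true}}\in\Delta^{D-1}$ (with respect to $(D-1)$-dimensional Hausdorff measure) the following holds for every $\hat x^*$ with $\hat x^*(s)\in\mathbf{FOP}(\theta^{\mathrm{true}},\phi^{\mathrm{true}},s)$ for all $s\in\mathcal S$. Every output $(\theta^{\sup},\phi^{\sup})$ of the algorithm, for every such solver, initial point and $K$, satisfies $\mathbb E_{S\sim\mathbb P_{\mathcal S}}\,\ell^{\mathrm{sub},0}(\hat x^*(S),\theta^{\sup},\phi^{\sup},S)\le 0$ (that is, the tolerance $\varepsilon=0$ is met), and $$\hat x^*(s)\in\mathbf{FOP}(\theta^{\sup},\phi^{\sup},s)\qquad\text{for all } s\in\mathcal S.$$ -/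

import Mathlib

open MeasureTheory

noncomputable section

namespace InverseMILP

/-- The probability simplex, as a subset of Euclidean space. -/
def simplex (D : ℕ) : Set (EuclideanSpace ℝ (Fin D)) :=
  {θ | (∀ i, 0 ≤ θ i) ∧ ∑ i, θ i = 1}

/-- The `(D - 1)`-dimensional surface (Hausdorff) measure on the simplex. -/
def simplexMeasure (D : ℕ) : Measure (EuclideanSpace ℝ (Fin D)) :=
  (μH[(D : ℝ) - 1]).restrict (simplex D)

section Polyhedra

variable {E F : Type*} [AddCommGroup E] [Module ℝ E] [AddCommGroup F] [Module ℝ F]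

/-- A convex polyhedron: the solution set of finitely many affine inequalities. -/
def IsPolyhedron (Q : Set E) : Prop :=
  ∃ (m : ℕ) (a : Fin m → E →ₗ[ℝ] ℝ) (b : Fin m → ℝ), Q = {x | ∀ i, a i x ≤ b i}

/-- A bounded convex polyhedron, presented as the convex hull of finitely many points. -/
def IsPolytope (P : Set E) : Prop :=
  ∃ V : Set E, V.Finite ∧ P = convexHull ℝ V

/-- `A` is a finite union of bounded convex polyhedra. -/
def IsPolytopeUnion (A : Set E) : Prop :=
  ∃ C : Set (Set E), C.Finite ∧ (∀ P ∈ C, IsPolytope P) ∧ A = ⋃₀ C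

/-- `Y` is the set of vertices of `A`, for some presentation of `A` as a finite union of bounded
convex polyhedra: the union of the vertex sets of these polyhedra. -/
def IsVertexSet (A Y : Set E) : Prop :=
  ∃ C : Set (Set E), C.Finite ∧ (∀ P ∈ C, IsPolytope P) ∧ A = ⋃₀ C ∧
    Y = ⋃ P ∈ C, Set.extremePoints ℝ P

/-- `h` is piecewise linear (affine) on `X`: finitely many polyhedra cover `X`, and on the part of
`X` inside each of them `h` agrees with an affine map. -/
def PiecewiseLinearOn (h : E → F) (X : Set E) : Prop :=
  ∃ C : Set (Set E), C.Finite ∧ (∀ Q ∈ C, IsPolyhedron Q) ∧ X ⊆ ⋃₀ C ∧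
    ∀ Q ∈ C, ∃ A : E →ᵃ[ℝ] F, Set.EqOn h A (X ∩ Q)

end Polyhedra

/-- `h` is a lattice homomorphism on the sublattice `Φ` of `ℝ^d`. -/
def IsLatticeHomOn {d J : ℕ} (h : (Fin d → ℝ) → (Fin J → ℝ)) (Φ : Set (Fin d → ℝ)) : Prop :=
  ∀ φ₁ ∈ Φ, ∀ φ₂ ∈ Φ, h (φ₁ ⊓ φ₂) = h φ₁ ⊓ h φ₂ ∧ h (φ₁ ⊔ φ₂) = h φ₁ ⊔ h φ₂

/-- The data of a parametric forward problem: maximise `⟪θ, f x s⟫` over `x ∈ X` subject to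
`g x φ s ≤ 0`. Only the values of `f` on `X` and of `g` on `X` and `Φ` matter. -/
structure Forward (k D d J : ℕ) (S : Type*) where
  X : Set (EuclideanSpace ℝ (Fin k))
  Φ : Set (Fin d → ℝ)
  f : EuclideanSpace ℝ (Fin k) → S → EuclideanSpace ℝ (Fin D)
  g : EuclideanSpace ℝ (Fin k) → (Fin d → ℝ) → S → (Fin J → ℝ)

namespace Forward

variable {k D d J N : ℕ} {S : Type*} (p : Forward k D d J S)

/-- The feasible set `X(φ, s)`. -/
def feasible (φ : Fin d → ℝ) (s : S) : Set (EuclideanSpace ℝ (Fin k)) :=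
  {x | x ∈ p.X ∧ p.g x φ s ≤ 0}

/-- The solution set `FOP(θ, φ, s)`. -/
def FOP (θ : EuclideanSpace ℝ (Fin D)) (φ : Fin d → ℝ) (s : S) :
    Set (EuclideanSpace ℝ (Fin k)) :=
  {x | x ∈ p.feasible φ s ∧
    ∀ x' ∈ p.feasible φ s, inner ℝ θ (p.f x' s) ≤ inner ℝ θ (p.f x s)}

/-- The suboptimality loss with penalty weight `lam`. -/
def suboptLoss (lam : ℝ) (x : EuclideanSpace ℝ (Fin k)) (θ : EuclideanSpace ℝ (Fin D))
    (φ : Fin d → ℝ) (s : S) : ℝ :=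
  max (sSup ((fun x' => inner ℝ θ (p.f x' s)) '' p.feasible φ s) - inner ℝ θ (p.f x s)) 0
    + lam * ∑ j, max (p.g x φ s j) 0

/-- The polyhedrality assumption: `f` and `g` are piecewise linear in `x`, and the feasible sets
are finite unions of bounded polyhedra. -/
structure Polyhedral : Prop where
  f_pl : ∀ s, PiecewiseLinearOn (fun x => p.f x s) p.X
  g_pl : ∀ φ ∈ p.Φ, ∀ s, PiecewiseLinearOn (fun x => p.g x φ s) p.X
  feasible_poly : ∀ φ ∈ p.Φ, ∀ s, IsPolytopeUnion (p.feasible φ s)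

/-- The lattice assumption on the constraints. -/
structure LatticeConstraints : Prop where
  sublattice : IsSublattice p.Φ
  hom : ∀ x ∈ p.X, ∀ s, IsLatticeHomOn (fun φ => p.g x φ s) p.Φ

/-- `φsup` is the lattice-supremal constraint parameter that is consistent with all the
observed solutions `xhat s`. -/
def IsPhiSup (xhat : S → EuclideanSpace ℝ (Fin k)) (φsup : Fin d → ℝ) : Prop :=
  IsGreatest {φ | φ ∈ p.Φ ∧ ∀ s, p.g (xhat s) φ s ≤ 0} φsup

/-- `xstar` solves the forward problems with constraint parameter `φ`, for all weights in the
simplex, and the image under `f` of each of its solutions lies in the vertex set `Y φ s`. -/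
def IsVertexSolver (Y : (Fin d → ℝ) → S → Set (EuclideanSpace ℝ (Fin D))) (φ : Fin d → ℝ)
    (xstar : EuclideanSpace ℝ (Fin D) → S → EuclideanSpace ℝ (Fin k)) : Prop :=
  ∀ θ ∈ simplex D, ∀ s, xstar θ s ∈ p.FOP θ φ s ∧ p.f (xstar θ s) s ∈ Y φ s

/-- `F(θ, s) = f(x*(θ, s), s) - f(xhat(s), s)`. -/
def gap (xhat : S → EuclideanSpace ℝ (Fin k))
    (xstar : EuclideanSpace ℝ (Fin D) → S → EuclideanSpace ℝ (Fin k))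
    (θ : EuclideanSpace ℝ (Fin D)) (s : S) : EuclideanSpace ℝ (Fin D) :=
  p.f (xstar θ s) s - p.f (xhat s) s

/-- The subgradient `(1/N) ∑ₙ F(θ, sₙ)` of the empirical suboptimality loss. -/
def meanGap (data : Fin N → S) (xhat : S → EuclideanSpace ℝ (Fin k))
    (xstar : EuclideanSpace ℝ (Fin D) → S → EuclideanSpace ℝ (Fin k))
    (θ : EuclideanSpace ℝ (Fin D)) : EuclideanSpace ℝ (Fin D) :=
  (1 / (N : ℝ)) • ∑ n, p.gap xhat xstar θ (data n)

/-- The empirical suboptimality loss `(1/N) ∑ₙ ℓ^{sub,0}(xhat(sₙ), θ, φ, sₙ)`. -/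
def empiricalLoss (data : Fin N → S) (xhat : S → EuclideanSpace ℝ (Fin k))
    (φ : Fin d → ℝ) (θ : EuclideanSpace ℝ (Fin D)) : ℝ :=
  (1 / (N : ℝ)) * ∑ n, p.suboptLoss 0 (xhat (data n)) θ φ (data n)

/-- `θ 1, …, θ K` are the iterates of projected subgradient descent on the simplex with step size
`k^{-1/2} / ‖subgradient‖`. When the subgradient vanishes the iterate does not move. -/
def IsPSGDRun (data : Fin N → S) (xhat : S → EuclideanSpace ℝ (Fin k))
    (xstar : EuclideanSpace ℝ (Fin D) → S → EuclideanSpace ℝ (Fin k))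
    (K : ℕ) (θ : ℕ → EuclideanSpace ℝ (Fin D)) : Prop :=
  θ 1 ∈ simplex D ∧
  ∀ i, 1 ≤ i → i < K →
    θ (i + 1) ∈ simplex D ∧
    ∀ η ∈ simplex D,
      dist (θ (i + 1)) (θ i - ((i : ℝ) ^ (-(1 / 2) : ℝ) * ‖p.meanGap data xhat xstar (θ i)‖⁻¹) •
          p.meanGap data xhat xstar (θ i)) ≤
      dist η (θ i - ((i : ℝ) ^ (-(1 / 2) : ℝ) * ‖p.meanGap data xhat xstar (θ i)‖⁻¹) •
          p.meanGap data xhat xstar (θ i))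

/-- `θbest` is an iterate among `θ 1, …, θ K` with least empirical suboptimality loss. -/
def IsBestIterate (data : Fin N → S) (xhat : S → EuclideanSpace ℝ (Fin k))
    (φ : Fin d → ℝ) (K : ℕ) (θ : ℕ → EuclideanSpace ℝ (Fin D))
    (θbest : EuclideanSpace ℝ (Fin D)) : Prop :=
  ∃ i, 1 ≤ i ∧ i ≤ K ∧ θbest = θ i ∧
    ∀ j, 1 ≤ j → j ≤ K →
      p.empiricalLoss data xhat φ θbest ≤ p.empiricalLoss data xhat φ (θ j)

/-- The constant `G`: the average diameter of the sets `f(X(φ, sₙ), sₙ)`. -/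
def diamConst (data : Fin N → S) (φ : Fin d → ℝ) : ℝ :=
  (1 / (N : ℝ)) * ∑ n, Metric.diam ((fun x => p.f x (data n)) '' p.feasible φ (data n))

/-- The constant `γ`. If `∑ₙ F(θ, sₙ) = 0` for all `θ` in the simplex, it takes the value `0`. -/
def gammaConst (data : Fin N → S) (xhat : S → EuclideanSpace ℝ (Fin k))
    (xstar : EuclideanSpace ℝ (Fin D) → S → EuclideanSpace ℝ (Fin k))
    (φ : Fin d → ℝ) (θtrue : EuclideanSpace ℝ (Fin D)) : ℝ :=
  -(1 / (4 * (N : ℝ) * p.diamConst data φ)) *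
    sSup ((fun θ => ∑ n, inner ℝ θtrue (p.gap xhat xstar θ (data n))) ''
      {θ | θ ∈ simplex D ∧ ∑ n, p.gap xhat xstar θ (data n) ≠ 0})

/-- `(θsup, φsup)` is an admissible output of the two-stage scheme with tolerance `ε`: first
`φsup` is the supremal consistent constraint parameter, then `θsup` is a weight whose expected
suboptimality loss is at most `ε`. -/
def IsTwoStageOutput [MeasurableSpace S] (P : Measure S) (xhat : S → EuclideanSpace ℝ (Fin k))
    (ε : ℝ) (θsup : EuclideanSpace ℝ (Fin D)) (φsup : Fin d → ℝ) : Prop :=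
  p.IsPhiSup xhat φsup ∧ θsup ∈ simplex D ∧
    ∫ s, p.suboptLoss 0 (xhat s) θsup φsup s ∂P ≤ ε

end Forward

/-- The number of iterations of projected subgradient descent that suffices, in terms of the
constant `γ` and of the squared distance `r` between the initial and the true weight. -/
def iterationBound (γ r : ℝ) : ℝ :=
  (2 / γ) ^ 2 * ((r + γ + 1) / 2 + Real.log (2 / γ)) ^ 2

end InverseMILP

end

/-! Each image `f(X(φtrue, s), s)` is a finite union of convex hulls of finite sets. For almost
every `θtrue` the functional `⟪θtrue, ·⟫` separates the generating points, since each coincidence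
confines it to a hyperplane section of the simplex, which has dimension at most `D - 2`. The
maximiser is then unique in image space (`eq_of_forall_le_of_generators`).

The true constraint parameter is consistent with the observations, so `φtrue ≤ φsup`. Monotonicity
of `g` makes the feasible set at `φsup` a subset of the true one that still contains every `xhat s`.
Hence `⟪θtrue, F(θ, s)⟫ ≤ 0`, with equality only if `F(θ, s) = 0`. A zero mean gap thus forces every
gap to vanish, which makes all observations optimal at `θ`.

It remains to reach a zero mean gap. Solver images lie in finite vertex sets, so nonzero mean gaps
have inner product with `θtrue` at most `-4γG`, where `γ > 0`, while their inner product with `θ` is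
nonnegative. Every normalised step then reduces the squared distance to `θtrue` by a definite amount
up to the squared step length, which cannot go on for `K` steps
(`IsPSGDRun.exists_meanGap_eq_zero`). Some iterate therefore has zero loss, and so does the best
one. -/

open Module

namespace InverseMILP

/-! ### Null sets and geometry of the simplex -/

section Generic

/-- The part of the simplex on a linear hyperplane is negligible for the surface measure. -/
theorem simplexMeasure_hyperplane {D : ℕ} {u : EuclideanSpace ℝ (Fin D)} (hu : u ≠ 0) :
    simplexMeasure D {θ | inner ℝ θ u = 0} = 0 := by
  have hmeas : MeasurableSet {θ : EuclideanSpace ℝ (Fin D) | inner ℝ θ u = 0} :=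
    (isClosed_eq (by fun_prop) continuous_const).measurableSet
  rw [simplexMeasure, Measure.restrict_apply hmeas]
  rcases Set.eq_empty_or_nonempty ({θ | inner ℝ θ u = 0} ∩ simplex D) with h | ⟨θ₀, h₀, h₀'⟩
  · rw [h, measure_empty]
  let σ : EuclideanSpace ℝ (Fin D) →ₗ[ℝ] ℝ := ∑ i, (EuclideanSpace.proj i).toLinearMap
  have hσ : ∀ x, σ x = ∑ i, x i := fun x => by simp [σ]
  let τ : EuclideanSpace ℝ (Fin D) →ₗ[ℝ] ℝ := (innerSL ℝ u).toLinearMap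
  have hτ : ∀ x, τ x = inner ℝ x u := fun x => by simp [τ, real_inner_comm]
  have h₁ : σ θ₀ = 1 := (hσ θ₀).trans h₀'.2
  have h₂ : τ θ₀ = 0 := (hτ θ₀).trans h₀
  have hlt₁ : LinearMap.ker σ < ⊤ := by
    refine lt_top_iff_ne_top.2 fun h => ?_
    have : θ₀ ∈ LinearMap.ker σ := h ▸ Submodule.mem_top
    rw [LinearMap.mem_ker, h₁] at this
    exact one_ne_zero this
  have hlt₂ : LinearMap.ker σ ⊓ LinearMap.ker τ < LinearMap.ker σ := by
    refine lt_of_le_of_ne inf_le_left fun h => hu ?_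
    -- Subtracting a multiple of `θ₀` puts `u` into `ker σ` without changing its value under `τ`,
    -- which is `‖u‖ ^ 2`.
    have hu' : u - σ u • θ₀ ∈ LinearMap.ker σ ⊓ LinearMap.ker τ := by
      rw [h, LinearMap.mem_ker]
      simp [h₁]
    have hu'' := hu'.2
    rw [SetLike.mem_coe, LinearMap.mem_ker, map_sub, map_smul, h₂, smul_zero, sub_zero, hτ] at hu''
    exact inner_self_eq_zero.1 hu''
  have hrank : finrank ℝ ↥(LinearMap.ker σ ⊓ LinearMap.ker τ) + 1 < D := by
    have h₃ := Submodule.finrank_lt_finrank_of_lt hlt₁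
    have h₄ := Submodule.finrank_lt_finrank_of_lt hlt₂
    rw [finrank_top, finrank_euclideanSpace_fin] at h₃
    omega
  set T := LinearMap.ker σ ⊓ LinearMap.ker τ
  have hiso : Isometry fun t : T => (t : EuclideanSpace ℝ (Fin D)) + θ₀ :=
    Isometry.of_dist_eq fun a b => by simp [Subtype.dist_eq]
  have hsub : {θ | inner ℝ θ u = 0} ∩ simplex D ⊆
      (fun t : T => (t : EuclideanSpace ℝ (Fin D)) + θ₀) '' Set.univ := by
    rintro θ ⟨hθ, hθ'⟩
    refine ⟨⟨θ - θ₀, ?_, ?_⟩, trivial, by simp⟩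
    · rw [SetLike.mem_coe, LinearMap.mem_ker, map_sub, h₁, hσ, hθ'.2, sub_self]
    · rw [SetLike.mem_coe, LinearMap.mem_ker, map_sub, h₂, hτ, sub_zero]
      exact hθ
  have hdim : dimH ({θ | inner ℝ θ u = 0} ∩ simplex D) < ((D - 1 : ℕ) : NNReal) := by
    refine (dimH_mono hsub).trans_lt ?_
    rw [hiso.dimH_image, Real.dimH_univ_eq_finrank]
    exact_mod_cast (by omega : finrank ℝ T < D - 1)
  have hcast : (D : ℝ) - 1 = (((D - 1 : ℕ) : NNReal) : ℝ) := by
    rw [NNReal.coe_natCast, Nat.cast_sub (by omega), Nat.cast_one]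
  rw [hcast]
  exact hausdorffMeasure_of_dimH_lt hdim

theorem isClosed_simplex (D : ℕ) : IsClosed (simplex D) := by
  have : simplex D = (⋂ i, {θ | 0 ≤ θ i}) ∩ {θ | ∑ i, θ i = 1} := by
    ext; simp [simplex]
  rw [this]
  exact (isClosed_iInter fun i => isClosed_le continuous_const (by fun_prop)).inter
    (isClosed_eq (by fun_prop) continuous_const)

theorem convex_simplex (D : ℕ) : Convex ℝ (simplex D) := by
  rintro x ⟨hx, hx'⟩ y ⟨hy, hy'⟩ a b ha hb hab
  refine ⟨fun i => ?_, ?_⟩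
  · simpa using add_nonneg (mul_nonneg ha (hx i)) (mul_nonneg hb (hy i))
  · simp [Finset.sum_add_distrib, ← Finset.mul_sum, hx', hy', hab]

theorem norm_le_one_of_mem_simplex {D : ℕ} {θ : EuclideanSpace ℝ (Fin D)} (hθ : θ ∈ simplex D) :
    ‖θ‖ ≤ 1 := by
  rw [EuclideanSpace.norm_eq, Real.sqrt_le_one]
  rw [← hθ.2]
  refine Finset.sum_le_sum fun i _ => ?_
  have h₁ : θ i ≤ 1 := hθ.2 ▸ Finset.single_le_sum (fun j _ => hθ.1 j) (Finset.mem_univ i)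
  rw [Real.norm_of_nonneg (hθ.1 i)]
  nlinarith [hθ.1 i]

/-- A weight almost surely takes distinct values at the points of a finite set. -/
theorem ae_injOn_inner {D : ℕ} {W : Set (EuclideanSpace ℝ (Fin D))} (hW : W.Finite) :
    ∀ᵐ θ ∂(simplexMeasure D), Set.InjOn (fun v => (inner ℝ θ v : ℝ)) W := by
  have : ∀ᵐ θ ∂(simplexMeasure D), ∀ v ∈ W, ∀ w ∈ W, inner ℝ θ v = inner ℝ θ w → v = w := by
    refine (ae_ball_iff hW.countable).2 fun v _ => (ae_ball_iff hW.countable).2 fun w _ => ?_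
    by_cases hvw : v = w
    · exact ae_of_all _ fun _ _ => hvw
    have h0 := simplexMeasure_hyperplane (sub_ne_zero.2 hvw)
    filter_upwards [measure_eq_zero_iff_ae_notMem.1 h0] with θ hθ h
    exact absurd (by simp [inner_sub_right, h]) hθ
  filter_upwards [this] with θ hθ v hv w hw h using hθ v hv w hw h

end Generic

/-! ### Linear maximisation over finite unions of polytopes -/

section Polytopes

variable {E : Type*} [NormedAddCommGroup E] [InnerProductSpace ℝ E]

/-- If a linear functional separates the points of `V`, then a point of the convex hull at which it
is maximal belongs to `V`. -/
theorem mem_of_mem_convexHull_of_forall_le {V : Set E} {θ x : E}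
    (hinj : Set.InjOn (fun v => (inner ℝ θ v : ℝ)) V) (hx : x ∈ convexHull ℝ V)
    (hmax : ∀ v ∈ V, (inner ℝ θ v : ℝ) ≤ inner ℝ θ x) : x ∈ V := by
  by_cases hv : ∃ v ∈ V, (inner ℝ θ v : ℝ) = inner ℝ θ x
  · obtain ⟨v, hv, hvx⟩ := hv
    -- An open half-space with one boundary point added is still convex. By injectivity it contains
    -- `V`, hence also `x`, and `x` can only be the added point.
    have hconv : Convex ℝ {z : E | (inner ℝ θ z : ℝ) < inner ℝ θ x ∨ z = v} := by
      intro y hy z hz a b ha hb hab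
      have hle : ∀ z : E, ((inner ℝ θ z : ℝ) < inner ℝ θ x ∨ z = v) →
          (inner ℝ θ z : ℝ) ≤ inner ℝ θ x := by
        rintro z (hz | rfl)
        exacts [hz.le, hvx.le]
      have hy' := hle y hy
      have hz' := hle z hz
      rcases ha.eq_or_lt with rfl | ha
      · obtain rfl : b = 1 := by linarith
        simpa using hz
      rcases hb.eq_or_lt with rfl | hb
      · obtain rfl : a = 1 := by linarith
        simpa using hy
      simp only [Set.mem_ofPred_eq, inner_add_right, inner_smul_right]
      obtain rfl : b = 1 - a := by linarith
      rcases hy with hy | rfl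
      · left; nlinarith
      rcases hz with hz | rfl
      · left; nlinarith
      right
      rw [← add_smul, hab, one_smul]
    have hsub : V ⊆ {z : E | (inner ℝ θ z : ℝ) < inner ℝ θ x ∨ z = v} := by
      intro w hw
      rcases (hmax w hw).lt_or_eq with h | h
      · exact Or.inl h
      · exact Or.inr (hinj hw hv (h.trans hvx.symm))
    rcases convexHull_min hsub hconv hx with h | rfl
    · exact absurd h (lt_irrefl _)
    · exact hv
  · push Not at hv
    have hconv : Convex ℝ {z : E | (inner ℝ θ z : ℝ) < inner ℝ θ x} :=
      convex_halfSpace_lt (innerSL ℝ θ).toLinearMap.isLinear _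
    have hlt : (inner ℝ θ x : ℝ) < inner ℝ θ x :=
      convexHull_min (fun w hw => (hmax w hw).lt_of_ne (hv w hw)) hconv hx
    exact absurd hlt (lt_irrefl _)

/-- A finite union of polytopes is generated by a finite set of points. -/
theorem IsVertexSet.exists_generators {A Y : Set E} (h : IsVertexSet A Y) :
    ∃ W : Set E, W.Finite ∧ ∀ x ∈ A, ∃ V ⊆ W, V ⊆ A ∧ x ∈ convexHull ℝ V := by
  obtain ⟨C, hC, hP, rfl, -⟩ := h
  choose! V hV hPV using hP
  refine ⟨⋃ P ∈ C, V P, hC.biUnion hV, ?_⟩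
  rintro x ⟨P, hPC, hx⟩
  refine ⟨V P, Set.subset_biUnion_of_mem hPC, ?_, hPV P hPC ▸ hx⟩
  refine Set.Subset.trans ?_ (Set.subset_sUnion_of_mem hPC)
  conv_rhs => rw [hPV P hPC]
  exact subset_convexHull ℝ _

theorem IsVertexSet.finite {A Y : Set E} (h : IsVertexSet A Y) : Y.Finite := by
  obtain ⟨C, hC, hP, -, rfl⟩ := h
  refine hC.biUnion fun P hPC => ?_
  obtain ⟨V, hV, rfl⟩ := hP P hPC
  exact hV.subset extremePoints_convexHull_subset

theorem IsVertexSet.isBounded {A Y : Set E} (h : IsVertexSet A Y) : Bornology.IsBounded A := by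
  obtain ⟨C, hC, hP, rfl, -⟩ := h
  refine (Bornology.isBounded_sUnion hC).2 fun P hPC => ?_
  obtain ⟨V, hV, rfl⟩ := hP P hPC
  exact isBounded_convexHull.2 hV.isBounded

/-- Uniqueness of the maximiser over a finite union of polytopes. -/
theorem eq_of_forall_le_of_generators {A W : Set E} {θ x y : E}
    (hW : ∀ x ∈ A, ∃ V ⊆ W, V ⊆ A ∧ x ∈ convexHull ℝ V)
    (hinj : Set.InjOn (fun v => (inner ℝ θ v : ℝ)) W) (hx : x ∈ A) (hy : y ∈ A)
    (hmax : ∀ z ∈ A, (inner ℝ θ z : ℝ) ≤ inner ℝ θ x)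
    (hxy : (inner ℝ θ y : ℝ) = inner ℝ θ x) : y = x := by
  have key : ∀ z ∈ A, (inner ℝ θ z : ℝ) = inner ℝ θ x → z ∈ W := by
    intro z hz hzx
    obtain ⟨V, hVW, hVA, hzV⟩ := hW z hz
    exact hVW (mem_of_mem_convexHull_of_forall_le (hinj.mono hVW) hzV
      fun v hv => hzx ▸ hmax v (hVA hv))
  exact hinj (key y hy hxy) (key x hx rfl) hxy

end Polytopes

/-! ### Estimates for projected subgradient descent -/

section Descent

variable {E : Type*} [NormedAddCommGroup E] [InnerProductSpace ℝ E]

/-- Moving to a nearest point of a convex set does not increase the distance to its points. -/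
theorem norm_sub_le_of_forall_dist_le {C : Set E} (hC : Convex ℝ C) {x y η : E}
    (hx : x ∈ C) (hη : η ∈ C) (hmin : ∀ z ∈ C, dist x y ≤ dist z y) : ‖x - η‖ ≤ ‖y - η‖ := by
  have hinf : ‖y - x‖ = ⨅ w : C, ‖y - w‖ := by
    have : Nonempty C := ⟨⟨x, hx⟩⟩
    refine le_antisymm (le_ciInf fun w => ?_) (ciInf_le ⟨0, ?_⟩ (⟨x, hx⟩ : C))
    · have := hmin w w.2
      rwa [dist_comm, dist_comm (w : E), dist_eq_norm, dist_eq_norm] at this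
    · rintro _ ⟨w, rfl⟩
      exact norm_nonneg _
  have hle := (norm_eq_iInf_iff_real_inner_le_zero hC hx).1 hinf η hη
  have hneg : (inner ℝ (y - x) (η - x) : ℝ) = -inner ℝ (y - x) (x - η) := by
    rw [← inner_neg_right, neg_sub]
  have hexp := norm_add_sq_real (y - x) (x - η)
  rw [sub_add_sub_cancel] at hexp
  refine (sq_le_sq₀ (norm_nonneg _) (norm_nonneg _)).1 ?_
  nlinarith [sq_nonneg ‖y - x‖]

/-- The square of the distance to `η` after a normalised step along a subgradient `v`. -/
theorem norm_sub_sq_step_le {θ η v : E} {t c B : ℝ} (ht : 0 ≤ t) (hv : v ≠ 0) (hvB : ‖v‖ ≤ B)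
    (hc : 0 ≤ c) (h : c * B ≤ inner ℝ v (θ - η)) :
    ‖θ - (t * ‖v‖⁻¹) • v - η‖ ^ 2 ≤ ‖θ - η‖ ^ 2 - 2 * t * c + t ^ 2 := by
  have hv' : 0 < ‖v‖ := norm_pos_iff.2 hv
  have hexp := norm_sub_sq_real (θ - η) ((t * ‖v‖⁻¹) • v)
  rw [sub_right_comm, hexp, inner_smul_right, norm_smul, real_inner_comm,
    Real.norm_of_nonneg (by positivity), inv_mul_cancel_right₀ hv'.ne']
  have h₁ : c ≤ ‖v‖⁻¹ * inner ℝ v (θ - η) := by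
    rw [inv_mul_eq_div, le_div_iff₀ hv']
    exact (mul_le_mul_of_nonneg_left hvB hc).trans h
  nlinarith [mul_le_mul_of_nonneg_left h₁ ht]

/-- The descent recursion with step sizes `i ^ (-1/2)`, summed up. -/
theorem sqrt_mul_le_of_descent {a : ℕ → ℝ} {c : ℝ} {K : ℕ} (hc : 0 ≤ c)
    (ha : 0 ≤ a (K + 1))
    (hstep : ∀ i, 1 ≤ i → i ≤ K →
      a (i + 1) ≤ a i - 2 * (i : ℝ) ^ (-(1 / 2) : ℝ) * c + ((i : ℝ) ^ (-(1 / 2) : ℝ)) ^ 2) :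
    2 * c * Real.sqrt K ≤ a 1 + 1 + Real.log K := by
  have hsq : ∀ i : ℕ, 1 ≤ i → ((i : ℝ) ^ (-(1 / 2) : ℝ)) ^ 2 = (i : ℝ)⁻¹ := by
    intro i hi
    rw [← Real.rpow_natCast, ← Real.rpow_mul (by positivity)]
    norm_num [Real.rpow_neg_one]
  have hrp : ∀ i : ℕ, (i : ℝ) ^ (-(1 / 2) : ℝ) = (Real.sqrt i)⁻¹ := by
    intro i
    rw [Real.rpow_neg (by positivity), Real.sqrt_eq_rpow]
  -- Every step length up to `K` is at least `K ^ (-1/2)`, so the linear terms sum to at least `2 *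
  -- c * √K`. The squared step lengths sum to a harmonic number.
  have hsum : ∀ m ≤ K, a (m + 1) ≤ a 1 - 2 * c * ((m : ℝ) * (Real.sqrt K)⁻¹)
      + (harmonic m : ℝ) := by
    intro m
    induction m with
    | zero => simp
    | succ m ih =>
      intro hm
      have h₁ := ih (by omega)
      have h₂ := hstep (m + 1) (by omega) hm
      rw [hsq _ (by omega), hrp] at h₂
      have h₃ : (Real.sqrt K)⁻¹ ≤ (Real.sqrt ((m + 1 : ℕ) : ℝ))⁻¹ :=
        inv_anti₀ (by positivity) (Real.sqrt_le_sqrt (by exact_mod_cast hm))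
      have h₄ := mul_le_mul_of_nonneg_left h₃ hc
      rw [harmonic_succ]
      push_cast at h₂ h₄ ⊢
      nlinarith
  have hK := hsum K le_rfl
  have hdiv : (K : ℝ) * (Real.sqrt K)⁻¹ = Real.sqrt K := by
    rw [← div_eq_mul_inv, Real.div_sqrt]
  have hharm := harmonic_le_one_add_log K
  rw [hdiv] at hK
  linarith

/-- The number of iterations excludes the conclusion of the descent recursion. -/
theorem lt_of_iterationBound_le {γ r : ℝ} {K : ℕ} (hγ : 0 < γ) (hγ' : γ ≤ 2) (hr : 0 ≤ r)
    (hK1 : 1 ≤ K) (hK : iterationBound γ r ≤ K) :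
    r + 1 + Real.log K < 2 * (4 * γ) * Real.sqrt K := by
  have hKpos : (0 : ℝ) < K := by exact_mod_cast hK1
  set u := Real.sqrt K with hu
  have hupos : 0 < u := Real.sqrt_pos.2 hKpos
  have hlog2 : 0 ≤ Real.log (2 / γ) := Real.log_nonneg (by rw [le_div_iff₀ hγ]; linarith)
  have hle : 2 / γ * ((r + γ + 1) / 2 + Real.log (2 / γ)) ≤ u := by
    refine Real.le_sqrt_of_sq_le ?_
    rw [mul_pow]
    exact hK
  have h₁ : r + γ + 1 + 2 * Real.log (2 / γ) ≤ γ * u := by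
    have := mul_le_mul_of_nonneg_left hle hγ.le
    field_simp at this
    linarith
  have hlogK : Real.log K = 2 * Real.log u := by
    rw [← Real.sq_sqrt hKpos.le, ← hu, Real.log_pow]
    norm_num
  -- This splitting produces the `log (2 / γ)` of the bound. With `log x ≤ x - 1` at `x = γ * u /
  -- 2`, the left side of the goal is at most `2 * γ * u - γ - 2`.
  have hlogu : Real.log u = Real.log (γ * u / 2) + Real.log (2 / γ) := by
    rw [← Real.log_mul (by positivity) (by positivity)]
    congr 1
    field_simp
  have h₂ := Real.log_le_sub_one_of_pos (show 0 < γ * u / 2 by positivity)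
  have h₃ : 0 < γ * u := by positivity
  linarith

end Descent

/-! ### Forward problems, losses and descent runs -/

namespace Forward

variable {k D d J N : ℕ} {S : Type*} {p : Forward k D d J S}

/-- Preservation of meets makes `g` monotone in `φ`, so larger parameters are more restrictive. -/
theorem feasible_subset_of_le (hlat : p.LatticeConstraints) {φ₁ φ₂ : Fin d → ℝ}
    (h₁ : φ₁ ∈ p.Φ) (h₂ : φ₂ ∈ p.Φ) (hle : φ₁ ≤ φ₂) (s : S) :
    p.feasible φ₂ s ⊆ p.feasible φ₁ s := by
  rintro x ⟨hx, hg⟩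
  refine ⟨hx, le_trans ?_ hg⟩
  have := (hlat.hom x hx s φ₁ h₁ φ₂ h₂).1
  rw [inf_eq_left.2 hle] at this
  exact inf_eq_left.1 this.symm

/-- The suboptimality loss without penalty vanishes at solutions. -/
theorem suboptLoss_zero_eq {φ : Fin d → ℝ} {θ : EuclideanSpace ℝ (Fin D)} {s : S}
    {x y : EuclideanSpace ℝ (Fin k)} (hy : y ∈ p.FOP θ φ s) (hx : x ∈ p.feasible φ s) :
    p.suboptLoss 0 x θ φ s = inner ℝ θ (p.f y s) - inner ℝ θ (p.f x s) := by
  have hgr : IsGreatest ((fun x' => (inner ℝ θ (p.f x' s) : ℝ)) '' p.feasible φ s)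
      (inner ℝ θ (p.f y s)) :=
    ⟨⟨y, hy.1, rfl⟩, by rintro _ ⟨z, hz, rfl⟩; exact hy.2 z hz⟩
  rw [suboptLoss, hgr.csSup_eq, zero_mul, add_zero, max_eq_left (sub_nonneg.2 (hy.2 x hx))]

theorem suboptLoss_zero_eq_zero_iff {φ : Fin d → ℝ} {θ : EuclideanSpace ℝ (Fin D)} {s : S}
    {x y : EuclideanSpace ℝ (Fin k)} (hy : y ∈ p.FOP θ φ s) (hx : x ∈ p.feasible φ s) :
    p.suboptLoss 0 x θ φ s = 0 ↔ x ∈ p.FOP θ φ s := by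
  constructor
  · intro h
    rw [suboptLoss_zero_eq hy hx, sub_eq_zero] at h
    exact ⟨hx, fun z hz => h ▸ hy.2 z hz⟩
  · intro h
    rw [suboptLoss_zero_eq h hx, sub_self]

theorem suboptLoss_zero_nonneg (φ : Fin d → ℝ) (θ : EuclideanSpace ℝ (Fin D)) (s : S)
    (x : EuclideanSpace ℝ (Fin k)) : 0 ≤ p.suboptLoss 0 x θ φ s := by
  rw [suboptLoss, zero_mul, add_zero]
  exact le_max_right _ _

theorem empiricalLoss_nonneg (data : Fin N → S) (xhat : S → EuclideanSpace ℝ (Fin k))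
    (φ : Fin d → ℝ) (θ : EuclideanSpace ℝ (Fin D)) : 0 ≤ p.empiricalLoss data xhat φ θ :=
  mul_nonneg (by positivity) (Finset.sum_nonneg fun _ _ => suboptLoss_zero_nonneg _ _ _ _)

/-- The empirical loss vanishes if and only if all observations are optimal. -/
theorem empiricalLoss_eq_zero_iff (hN : 0 < N) {data : Fin N → S}
    (hdata : Function.Surjective data) {xhat : S → EuclideanSpace ℝ (Fin k)} {φ : Fin d → ℝ}
    {θ : EuclideanSpace ℝ (Fin D)} (hfeas : ∀ s, xhat s ∈ p.feasible φ s)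
    (hsol : ∀ s, (p.FOP θ φ s).Nonempty) :
    p.empiricalLoss data xhat φ θ = 0 ↔ ∀ s, xhat s ∈ p.FOP θ φ s := by
  have hN' : (1 / (N : ℝ)) ≠ 0 := by positivity
  rw [empiricalLoss, mul_eq_zero, or_iff_right hN',
    Finset.sum_eq_zero_iff_of_nonneg fun _ _ => suboptLoss_zero_nonneg _ _ _ _, hdata.forall]
  simp only [Finset.mem_univ, true_imp_iff]
  exact forall_congr' fun n =>
    suboptLoss_zero_eq_zero_iff (hsol (data n)).some_mem (hfeas (data n))

theorem IsPSGDRun.mem_simplex {data : Fin N → S} {xhat : S → EuclideanSpace ℝ (Fin k)}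
    {xstar : EuclideanSpace ℝ (Fin D) → S → EuclideanSpace ℝ (Fin k)} {K : ℕ}
    {θ : ℕ → EuclideanSpace ℝ (Fin D)} (h : p.IsPSGDRun data xhat xstar K θ) {i : ℕ}
    (hi : 1 ≤ i) (hiK : i ≤ K) : θ i ∈ simplex D := by
  rcases hi.eq_or_lt with rfl | hi
  · exact h.1
  · obtain ⟨j, rfl⟩ : ∃ j, i = j + 1 := ⟨i - 1, by omega⟩
    exact (h.2 j (by omega) (by omega)).1

/-- Projected subgradient descent reaches a weight with vanishing subgradient, if all nonzero
subgradients are bounded by `B` and make an angle with `η` that is bounded away from a right one. -/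
theorem IsPSGDRun.exists_meanGap_eq_zero {data : Fin N → S}
    {xhat : S → EuclideanSpace ℝ (Fin k)}
    {xstar : EuclideanSpace ℝ (Fin D) → S → EuclideanSpace ℝ (Fin k)} {K : ℕ}
    {θ : ℕ → EuclideanSpace ℝ (Fin D)} (h : p.IsPSGDRun data xhat xstar K θ) (hK1 : 1 ≤ K)
    {η : EuclideanSpace ℝ (Fin D)} (hη : η ∈ simplex D) {γ B : ℝ} (hγ : 0 < γ)
    (hB : ∀ θ ∈ simplex D, ‖p.meanGap data xhat xstar θ‖ ≤ B)
    (hnonneg : ∀ θ ∈ simplex D, (0 : ℝ) ≤ inner ℝ (p.meanGap data xhat xstar θ) θ)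
    (hneg : ∀ θ ∈ simplex D, p.meanGap data xhat xstar θ ≠ 0 →
      inner ℝ (p.meanGap data xhat xstar θ) η ≤ -(4 * γ * B))
    (hK : iterationBound γ (‖θ 1 - η‖ ^ 2) ≤ K) :
    ∃ i, 1 ≤ i ∧ i ≤ K ∧ p.meanGap data xhat xstar (θ i) = 0 := by
  by_contra! hne
  -- Cauchy–Schwarz with `‖η‖ ≤ 1` gives `4 * γ * B ≤ B`, and `B > 0`.
  have hγ' : γ ≤ 2 := by
    have h₁ := hneg (θ 1) h.1 (hne 1 le_rfl hK1)
    have h₂ := hB (θ 1) h.1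
    have h₃ : 0 < ‖p.meanGap data xhat xstar (θ 1)‖ := norm_pos_iff.2 (hne 1 le_rfl hK1)
    have h₄ := abs_le.1 (abs_real_inner_le_norm (p.meanGap data xhat xstar (θ 1)) η)
    have h₅ := mul_le_mul_of_nonneg_left (norm_le_one_of_mem_simplex hη) h₃.le
    by_contra! hlt
    nlinarith [mul_pos (h₃.trans_le h₂) (sub_pos.2 hlt)]
  have hstep : ∀ i, 1 ≤ i → i ≤ K →
      ‖θ i - ((i : ℝ) ^ (-(1 / 2) : ℝ) * ‖p.meanGap data xhat xstar (θ i)‖⁻¹) •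
        p.meanGap data xhat xstar (θ i) - η‖ ^ 2 ≤
      ‖θ i - η‖ ^ 2 - 2 * (i : ℝ) ^ (-(1 / 2) : ℝ) * (4 * γ) +
        ((i : ℝ) ^ (-(1 / 2) : ℝ)) ^ 2 := by
    intro i hi hiK
    have hmem := h.mem_simplex hi hiK
    refine norm_sub_sq_step_le (by positivity) (hne i hi hiK) (hB _ hmem) (by positivity) ?_
    rw [inner_sub_right]
    linarith [hnonneg _ hmem, hneg _ hmem (hne i hi hiK)]
  refine absurd (lt_of_iterationBound_le hγ hγ' (sq_nonneg _) hK1 hK) (not_lt.2 ?_)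
  -- The run makes only `K - 1` projections. Setting the sequence to `0` at `K + 1` still uses the
  -- subgradient at `θ K`: the squared distance after that unprojected step is nonnegative.
  have := sqrt_mul_le_of_descent (a := fun i => if i ≤ K then ‖θ i - η‖ ^ 2 else 0)
    (c := 4 * γ) (K := K) (by positivity) (by simp) fun i hi hiK => by
      have hs := hstep i hi hiK
      simp only [if_pos hiK]
      split_ifs with hi'
      · obtain ⟨hmem, hmin⟩ := h.2 i hi hi'
        exact (pow_le_pow_left₀ (norm_nonneg _)
          (norm_sub_le_of_forall_dist_le (convex_simplex D) hmem hη hmin) 2).trans hs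
      · exact (sq_nonneg _).trans hs
  simpa only [if_pos hK1] using this

section Gap

variable {data : Fin N → S} {xhat : S → EuclideanSpace ℝ (Fin k)}
  {xstar : EuclideanSpace ℝ (Fin D) → S → EuclideanSpace ℝ (Fin k)} {φ : Fin d → ℝ}

theorem inner_meanGap (θ η : EuclideanSpace ℝ (Fin D)) :
    (inner ℝ (p.meanGap data xhat xstar θ) η : ℝ) =
      1 / (N : ℝ) * ∑ n, inner ℝ η (p.gap xhat xstar θ (data n)) := by
  rw [meanGap, real_inner_smul_left, real_inner_comm, inner_sum]

theorem meanGap_eq_zero_iff (hN : 0 < N) (θ : EuclideanSpace ℝ (Fin D)) :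
    p.meanGap data xhat xstar θ = 0 ↔ ∑ n, p.gap xhat xstar θ (data n) = 0 := by
  rw [meanGap, smul_eq_zero, or_iff_right (by positivity)]

/-- Each gap joins two points of the image of the feasible set. Boundedness matters because
`Metric.diam` is `0` on unbounded sets. -/
theorem norm_meanGap_le_diamConst
    (hbdd : ∀ s, Bornology.IsBounded ((fun x => p.f x s) '' p.feasible φ s))
    (hfeas : ∀ s, xhat s ∈ p.feasible φ s) {θ : EuclideanSpace ℝ (Fin D)}
    (hstar : ∀ s, xstar θ s ∈ p.feasible φ s) :
    ‖p.meanGap data xhat xstar θ‖ ≤ p.diamConst data φ := by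
  rw [meanGap, diamConst, norm_smul, Real.norm_of_nonneg (by positivity)]
  refine mul_le_mul_of_nonneg_left ((norm_sum_le _ _).trans ?_) (by positivity)
  refine Finset.sum_le_sum fun n _ => ?_
  rw [gap, ← dist_eq_norm]
  exact Metric.dist_le_diam_of_mem (hbdd _) (Set.mem_image_of_mem _ (hstar _))
    (Set.mem_image_of_mem _ (hfeas _))

/-- If `xhat` is the solution at `η`, uniquely up to its image under `f`, then `γ` is positive and
bounds the component of the nonzero subgradients along `η`. -/
theorem gammaConst_pos_and_le [Finite S] (hN : 0 < N) {Y : S → Set (EuclideanSpace ℝ (Fin D))}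
    (hYfin : ∀ s, (Y s).Finite)
    (hxY : ∀ θ ∈ simplex D, ∀ s, p.f (xstar θ s) s ∈ Y s)
    (hpos : ∀ θ ∈ simplex D, p.meanGap data xhat xstar θ ≠ 0 → 0 < p.diamConst data φ)
    {η : EuclideanSpace ℝ (Fin D)}
    (hneg : ∀ θ ∈ simplex D, p.meanGap data xhat xstar θ ≠ 0 →
      ∑ n, (inner ℝ η (p.gap xhat xstar θ (data n)) : ℝ) < 0)
    (hex : ∃ θ ∈ simplex D, p.meanGap data xhat xstar θ ≠ 0) :
    0 < p.gammaConst data xhat xstar φ η ∧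
      ∀ θ ∈ simplex D, p.meanGap data xhat xstar θ ≠ 0 →
        inner ℝ (p.meanGap data xhat xstar θ) η ≤
          -(4 * p.gammaConst data xhat xstar φ η * p.diamConst data φ) := by
  set G := p.diamConst data φ with hG
  set A := (fun θ => ∑ n, (inner ℝ η (p.gap xhat xstar θ (data n)) : ℝ)) ''
      {θ | θ ∈ simplex D ∧ ∑ n, p.gap xhat xstar θ (data n) ≠ 0} with hA
  have hγ : p.gammaConst data xhat xstar φ η = -(1 / (4 * (N : ℝ) * G)) * sSup A := rfl
  -- The sum depends on `θ` only through a tuple of solver images, one in each finite `Y s`. The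
  -- supremum is therefore attained, and strict negativity passes to it.
  have hAfin : A.Finite := by
    have hpi : (Set.univ.pi Y).Finite := Set.Finite.pi' hYfin |>.subset fun v hv s => hv s trivial
    refine (hpi.image fun v => ∑ n, (inner ℝ η (v (data n) - p.f (xhat (data n)) (data n)) : ℝ)
      ).subset ?_
    rintro _ ⟨θ, hθ, rfl⟩
    exact ⟨fun s => p.f (xstar θ s) s, fun s _ => hxY θ hθ.1 s, rfl⟩
  have hAne : A.Nonempty := by
    obtain ⟨θ, hθ, hθ'⟩ := hex
    exact ⟨_, θ, ⟨hθ, (meanGap_eq_zero_iff hN θ).not.1 hθ'⟩, rfl⟩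
  have hGpos : 0 < G := by
    obtain ⟨θ, hθ, hθ'⟩ := hex
    exact hpos θ hθ hθ'
  have hN' : (0 : ℝ) < N := by exact_mod_cast hN
  have hsup : sSup A < 0 := by
    obtain ⟨θ, hθ, hθ'⟩ := hAne.csSup_mem hAfin
    rw [← hθ']
    exact hneg θ hθ.1 ((meanGap_eq_zero_iff hN θ).not.2 hθ.2)
  refine ⟨?_, fun θ hθ hθ' => ?_⟩
  · rw [hγ]
    exact mul_pos_of_neg_of_neg (neg_neg_of_pos (by positivity)) hsup
  · have hle : ∑ n, (inner ℝ η (p.gap xhat xstar θ (data n)) : ℝ) ≤ sSup A :=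
      le_csSup hAfin.bddAbove ⟨θ, ⟨hθ, (meanGap_eq_zero_iff hN θ).not.1 hθ'⟩, rfl⟩
    have heq : -(4 * p.gammaConst data xhat xstar φ η * G) = 1 / (N : ℝ) * sSup A := by
      rw [hγ]
      field_simp
    rw [inner_meanGap, heq]
    exact mul_le_mul_of_nonneg_left hle (by positivity)

end Gap

end Forward

end InverseMILP

/-! ### Exact recovery of optimality -/

open InverseMILP InverseMILP.Forward in
theorem mainTheorem1 {k D d J N : ℕ} {S : Type*} [Finite S] [Nonempty S]
    [MeasurableSpace S] [DiscreteMeasurableSpace S]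
    (p : InverseMILP.Forward k D d J S)
    (hpoly : p.Polyhedral) (hlat : p.LatticeConstraints)
    (Y : (Fin d → ℝ) → S → Set (EuclideanSpace ℝ (Fin D)))
    (hY : ∀ φ ∈ p.Φ, ∀ s,
      InverseMILP.IsVertexSet ((fun x => p.f x s) '' p.feasible φ s) (Y φ s))
    (P : MeasureTheory.Measure S) [MeasureTheory.IsProbabilityMeasure P]
    (data : Fin N → S) (hdata : Function.Surjective data)
    (φtrue : Fin d → ℝ) (hφtrue : φtrue ∈ p.Φ) :
    ∀ᵐ θtrue ∂(InverseMILP.simplexMeasure D),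
      ∀ xhat : S → EuclideanSpace ℝ (Fin k),
        (∀ s, xhat s ∈ p.FOP θtrue φtrue s) →
      ∀ φsup : Fin d → ℝ, p.IsPhiSup xhat φsup →
      ∀ xstar : EuclideanSpace ℝ (Fin D) → S → EuclideanSpace ℝ (Fin k),
        p.IsVertexSolver Y φsup xstar →
      ∀ (K : ℕ) (θ : ℕ → EuclideanSpace ℝ (Fin D)),
        p.IsPSGDRun data xhat xstar K θ →
        InverseMILP.iterationBound (p.gammaConst data xhat xstar φsup θtrue)
          (‖θ 1 - θtrue‖ ^ 2) ≤ K →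
      ∀ θsup : EuclideanSpace ℝ (Fin D),
        p.IsBestIterate data xhat φsup K θ θsup →
        p.IsTwoStageOutput P xhat 0 θsup φsup ∧
        ∀ s, xhat s ∈ p.FOP θsup φsup s := by
  have hN : 0 < N := by
    obtain ⟨n, -⟩ := hdata (Classical.arbitrary S)
    exact n.pos
  -- The generators depend only on `φtrue`, so the exceptional null set of weights is fixed before
  -- the observations, `φsup` and the solver are chosen.
  choose W hWfin hW using fun s => (hY φtrue hφtrue s).exists_generators
  have hgen : ∀ᵐ θ ∂(simplexMeasure D), ∀ s, Set.InjOn (fun v => (inner ℝ θ v : ℝ)) (W s) :=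
    ae_all_iff.2 fun s => ae_injOn_inner (hWfin s)
  have hmem : ∀ᵐ θ ∂(simplexMeasure D), θ ∈ simplex D :=
    ae_restrict_mem (isClosed_simplex D).measurableSet
  filter_upwards [hgen, hmem] with θtrue hinj hθtrue
  intro xhat hxhat φsup hφsup xstar hxstar K θ hrun hK θsup hbest
  have hφsup' : φsup ∈ p.Φ := hφsup.1.1
  have hle : φtrue ≤ φsup := hφsup.2 ⟨hφtrue, fun s => (hxhat s).1.2⟩
  have hsub : ∀ s, p.feasible φsup s ⊆ p.feasible φtrue s :=
    fun s => feasible_subset_of_le hlat hφtrue hφsup' hle s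
  have hfeas : ∀ s, xhat s ∈ p.feasible φsup s :=
    fun s => ⟨(hxhat s).1.1, hφsup.1.2 s⟩
  have hgap_le : ∀ θ ∈ simplex D, ∀ s, (inner ℝ θtrue (p.gap xhat xstar θ s) : ℝ) ≤ 0 := by
    intro θ hθ s
    rw [gap, inner_sub_right, sub_nonpos]
    exact (hxhat s).2 _ (hsub s (hxstar θ hθ s).1.1)
  have hgap_eq : ∀ θ ∈ simplex D, ∀ s, (inner ℝ θtrue (p.gap xhat xstar θ s) : ℝ) = 0 →
      p.gap xhat xstar θ s = 0 := by
    intro θ hθ s h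
    rw [gap, inner_sub_right, sub_eq_zero] at h
    rw [gap, sub_eq_zero]
    refine eq_of_forall_le_of_generators (hW s) (hinj s)
      (Set.mem_image_of_mem (fun x => p.f x s) (hxhat s).1)
      (Set.mem_image_of_mem (fun x => p.f x s) (hsub s (hxstar θ hθ s).1.1)) ?_ h
    rintro _ ⟨z, hz, rfl⟩
    exact (hxhat s).2 z hz
  have hsum_le : ∀ θ ∈ simplex D,
      ∑ n, (inner ℝ θtrue (p.gap xhat xstar θ (data n)) : ℝ) ≤ 0 :=
    fun θ hθ => Finset.sum_nonpos fun n _ => hgap_le θ hθ _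
  have hsum_eq : ∀ θ ∈ simplex D,
      ∑ n, (inner ℝ θtrue (p.gap xhat xstar θ (data n)) : ℝ) = 0 →
      ∀ s, p.gap xhat xstar θ s = 0 := by
    intro θ hθ h
    rw [hdata.forall]
    intro n
    exact hgap_eq θ hθ _
      ((Finset.sum_eq_zero_iff_of_nonpos fun n _ => hgap_le θ hθ _).1 h n (Finset.mem_univ n))
  have hsum_lt : ∀ θ ∈ simplex D, p.meanGap data xhat xstar θ ≠ 0 →
      ∑ n, (inner ℝ θtrue (p.gap xhat xstar θ (data n)) : ℝ) < 0 := by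
    intro θ hθ h
    refine (hsum_le θ hθ).lt_of_ne fun h0 => h ?_
    rw [meanGap_eq_zero_iff hN]
    exact Finset.sum_eq_zero fun n _ => hsum_eq θ hθ h0 _
  have hnorm : ∀ θ ∈ simplex D, ‖p.meanGap data xhat xstar θ‖ ≤ p.diamConst data φsup :=
    fun θ hθ => norm_meanGap_le_diamConst (fun s => (hY φsup hφsup' s).isBounded) hfeas
      fun s => (hxstar θ hθ s).1.1
  obtain ⟨i, hi, hiK, rfl, hmin⟩ := hbest
  have hzero : ∃ j, 1 ≤ j ∧ j ≤ K ∧ p.meanGap data xhat xstar (θ j) = 0 := by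
    -- If all mean gaps vanish, `γ` is `0` by the convention `sSup ∅ = 0` and the iteration bound
    -- says nothing, but every iterate already has zero mean gap.
    by_cases hex : ∃ θ ∈ simplex D, p.meanGap data xhat xstar θ ≠ 0
    · obtain ⟨hγ, hγle⟩ := gammaConst_pos_and_le (φ := φsup) (η := θtrue) hN
        (fun s => (hY φsup hφsup' s).finite) (fun θ hθ s => (hxstar θ hθ s).2)
        (fun θ hθ h => (norm_pos_iff.2 h).trans_le (hnorm θ hθ)) hsum_lt hex
      refine hrun.exists_meanGap_eq_zero (hi.trans hiK) hθtrue hγ hnorm (fun θ hθ => ?_) hγle hK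
      rw [inner_meanGap]
      refine mul_nonneg (by positivity) (Finset.sum_nonneg fun n _ => ?_)
      rw [gap, inner_sub_right, sub_nonneg]
      exact (hxstar θ hθ _).1.2 _ (hfeas _)
    · push Not at hex
      exact ⟨i, hi, hiK, hex _ (hrun.mem_simplex hi hiK)⟩
  obtain ⟨j, hj, hjK, hj0⟩ := hzero
  have hloss : ∀ i, 1 ≤ i → i ≤ K →
      (p.empiricalLoss data xhat φsup (θ i) = 0 ↔ ∀ s, xhat s ∈ p.FOP (θ i) φsup s) :=
    fun i hi hiK => empiricalLoss_eq_zero_iff hN hdata hfeas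
      fun s => ⟨_, (hxstar _ (hrun.mem_simplex hi hiK) s).1⟩
  have hjFOP : ∀ s, xhat s ∈ p.FOP (θ j) φsup s := by
    intro s
    have hθj := hrun.mem_simplex hj hjK
    have hg : p.gap xhat xstar (θ j) s = 0 := by
      refine hsum_eq _ hθj ?_ s
      rw [← inner_sum, (meanGap_eq_zero_iff hN _).1 hj0, inner_zero_right]
    rw [gap, sub_eq_zero] at hg
    exact ⟨hfeas s, fun z hz => hg ▸ (hxstar _ hθj s).1.2 z hz⟩
  -- The best iterate need not be `θ j`, but its nonnegative loss is at most the loss of `θ j`,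
  -- which is zero. As every state occurs in the data, zero empirical loss gives optimality in all
  -- states.
  have hFOP : ∀ s, xhat s ∈ p.FOP (θ i) φsup s :=
    (hloss i hi hiK).1 (le_antisymm ((hmin j hj hjK).trans ((hloss j hj hjK).2 hjFOP).le)
      (empiricalLoss_nonneg _ _ _ _))
  refine ⟨⟨hφsup, hrun.mem_simplex hi hiK, ?_⟩, hFOP⟩
  have hint : ∀ s, p.suboptLoss 0 (xhat s) (θ i) φsup s = 0 :=
    fun s => (suboptLoss_zero_eq_zero_iff (hFOP s) (hfeas s)).2 (hFOP s)
  simp [hint]
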